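/- For positive integers $j, n$ let $c_j(n)$ be the number of ordered factorisations of $n$ into $j$ integer factors, each at least $2$. Put $c_j^{(0)} = c_j$ and $c_j^{(r)}(n) = \sum_{d \mid n} c_j^{(r-1)}(d)$ for $r \ge 1$, so that $c_j^{(1)}(n) = \sum_{d\mid n} c_j(d)$. Let $\Omega(n)$ be the number of prime factors of $n$ counted with multiplicity, and let $$N_n = \sum_{j=1}^{\Omega(n)} c_j^{(0)}(n)\, c_j^{(1)}(n).$$ Let $m \ge 1$, and let $A, B$ be two sets of positive integers with exactly $m$ elements each. The unordered pair $\{A, B\}$ is called an $m+m$ (non-inclusive) sum-and-distance system if $$\{a+b,\ |a-b| : a\in A,\ b\in B\} = \{1,3,5,\dots,4m^2-1\},$$ and an $m+m$ inclusive sum-and-distance system if $$\{a,\ b,\ a+b,\ |a-b| : a\in A,\ b\in B\} = \{1,2,3,\dots,2m(m+1)\}.$$ Then for every integer $m\ge 1$ there are exactly $$N_{2m} = \sum_{j=1}^{\Omega(2m)} c_j^{(0)}(2m)\, c_j^{(1)}(2m)$$ different $m+m$ non-inclusive sum-and-distance systems, and exactly $$N_{2m+1} = \sum_{j=1}^{\Omega(2m+1)}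 c_j^{(0)}(2m+1)\, c_j^{(1)}(2m+1)$$ different $m+m$ inclusive sum-and-distance systems. -/

import Mathlib

/-- The `j`th non-trivial divisor function `c_j(n)`: the number of ordered factorisations of `n`
into `j` factors, each of which is at least `2`. -/
def nontrivialDivisor (j n : ℕ) : ℕ :=
  ((Nat.finMulAntidiag j n).filter (fun f => ∀ i, 2 ≤ f i)).card

/-- The associated divisor function `c_j^{(r)}(n)`: `c_j^{(0)} = c_j` and
`c_j^{(r)}(n) = ∑_{m ∣ n} c_j^{(r-1)}(m)`. -/
def assocDivisor (j : ℕ) : ℕ → ℕ → ℕ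
  | 0, n => nontrivialDivisor j n
  | r + 1, n => ∑ d ∈ n.divisors, assocDivisor j r d

/-- `N_n = ∑_{j=1}^{Ω(n)} c_j^{(0)}(n) c_j^{(1)}(n)`. -/
def countN (n : ℕ) : ℕ :=
  ∑ j ∈ Finset.Icc 1 (ArithmeticFunction.cardFactors n), assocDivisor j 0 n * assocDivisor j 1 n

/-- `S` is an `m+m` (non-inclusive) sum-and-distance system: `S = {A, B}` for `m`-element sets
`A, B` of positive integers such that the sums `a + b` and the distances `|a - b|`
(`a ∈ A`, `b ∈ B`) form the set `{1, 3, 5, …, 4m² - 1}`. -/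
def IsSumDistSystem (m : ℕ) (S : Finset (Finset ℕ)) : Prop :=
  ∃ A B : Finset ℕ, S = {A, B} ∧ A.card = m ∧ B.card = m ∧
    (∀ a ∈ A, 0 < a) ∧ (∀ b ∈ B, 0 < b) ∧
    {x : ℤ | ∃ a ∈ A, ∃ b ∈ B, x = (a : ℤ) + b ∨ x = |(a : ℤ) - b|} =
      {x : ℤ | Odd x ∧ 1 ≤ x ∧ x ≤ 4 * (m : ℤ) ^ 2 - 1}

/-- `S` is an `m+m` inclusive sum-and-distance system: `S = {A, B}` for `m`-element sets
`A, B` of positive integers such that the elements of `A`, those of `B`, the sums `a + b` and the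
distances `|a - b|` (`a ∈ A`, `b ∈ B`) form the set `{1, 2, 3, …, 2m(m+1)}`. -/
def IsInclusiveSumDistSystem (m : ℕ) (S : Finset (Finset ℕ)) : Prop :=
  ∃ A B : Finset ℕ, S = {A, B} ∧ A.card = m ∧ B.card = m ∧
    (∀ a ∈ A, 0 < a) ∧ (∀ b ∈ B, 0 < b) ∧
    {x : ℤ | ∃ a ∈ A, ∃ b ∈ B,
        x = (a : ℤ) ∨ x = (b : ℤ) ∨ x = (a : ℤ) + b ∨ x = |(a : ℤ) - b|} =
      {x : ℤ | 1 ≤ x ∧ x ≤ 2 * (m : ℤ) * (m + 1)}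

/-! ### Divisor functions and interlaced factorisations -/

section DivisorCounts

open Finset
open scoped ArithmeticFunction.Omega

/-! Both kinds of system are additive decompositions of an interval in disguise. Adjoin negatives:
for `n = 2m` take `±A`, `±B`; for `n = 2m + 1` take `±2A ∪ {0}`, `±2B ∪ {0}`. These symmetric sets
have `n` elements each, and their sums are the `n²` integers of absolute value below `n²` with the
parity of `n² - 1`. Shifting each set to start at 0 and halving gives a sum system: two `n`-element
sets whose sums are `0, …, n² - 1`, each obtained once (`IsCentredSystem.isSumSystem`). Conversely,
every sum system containing 1 in one of its sets is palindromic (`IsSumSystem.isPalindromic`), so it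
can be centred and halved.

Sum systems have a recursive structure. If `1 ∈ A` and `k` is the least positive element of `B`,
then `A` consists of blocks of length `k` and `B` of multiples of `k` (`IsSumSystem.mem_block`).
Dividing by `k` leaves a smaller sum system with the roles of the sets exchanged. Iteration encodes
the system as interlaced ordered factorisations of `#A` and `#B`, the former having as many factors
as the latter or one more. Accordingly `card_sumSystems` and `interlacedCount_eq_sum` are the same
recursion. For `#A = #B = n` the count is `∑ c_j (c_j + c_{j-1})`, which is `N_n` by an index shift,
since `c_j^{(1)} = c_j + c_{j+1}`. Unordered pairs are not overcounted: 1 lies in exactly one of the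
two sets and so orders them. -/

theorem nontrivialDivisor_zero {n : ℕ} (hn : n ≠ 1) : nontrivialDivisor 0 n = 0 := by
  simp [nontrivialDivisor, Nat.finMulAntidiag_zero_left hn]

theorem nontrivialDivisor_zero_one : nontrivialDivisor 0 1 = 1 := by
  simp [nontrivialDivisor, Nat.finMulAntidiag_one]

/-- Splitting off the first factor of an ordered factorisation. -/
theorem nontrivialDivisor_succ {n : ℕ} (hn : n ≠ 0) (j : ℕ) :
    nontrivialDivisor (j + 1) n = ∑ k ∈ n.divisors.erase 1, nontrivialDivisor j (n / k) := by
  simp only [nontrivialDivisor]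
  rw [← card_sigma]
  refine card_bij' (fun f _ => (⟨f 0, Fin.tail f⟩ : Σ _ : ℕ, Fin j → ℕ))
    (fun p _ => Fin.cons p.1 p.2) ?_ ?_ ?_ ?_
  · intro f hf
    simp only [mem_filter, Nat.mem_finMulAntidiag, Fin.prod_univ_succ] at hf
    obtain ⟨⟨hp, -⟩, h2⟩ := hf
    have h0 := h2 0
    have hdvd : f 0 ∣ n := ⟨_, hp.symm⟩
    simp only [mem_sigma, mem_erase, Nat.mem_divisors, mem_filter, Nat.mem_finMulAntidiag]
    refine ⟨⟨by omega, hdvd, hn⟩, ⟨?_, ?_⟩, fun i => h2 i.succ⟩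
    · rw [← hp, Nat.mul_div_cancel_left _ (by omega)]
      rfl
    · exact (Nat.div_pos (Nat.le_of_dvd (by omega) hdvd) (by omega)).ne'
  · rintro ⟨k, f⟩ hf
    simp only [mem_sigma, mem_erase, Nat.mem_divisors, mem_filter, Nat.mem_finMulAntidiag] at hf
    obtain ⟨⟨hk1, hk, -⟩, ⟨hp, -⟩, h2⟩ := hf
    have hk0 : 0 < k := Nat.pos_of_dvd_of_pos hk (by omega)
    simp only [mem_filter, Nat.mem_finMulAntidiag, Fin.prod_univ_succ, Fin.cons_zero,
      Fin.cons_succ, Fin.forall_fin_succ]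
    exact ⟨⟨by rw [hp, Nat.mul_div_cancel' hk], hn⟩, by omega, h2⟩
  · intro f _
    exact Fin.cons_self_tail f
  · rintro ⟨k, f⟩ _
    simp

theorem nontrivialDivisor_one_one : nontrivialDivisor 1 1 = 0 := by
  rw [nontrivialDivisor_succ one_ne_zero]
  simp

theorem nontrivialDivisor_one {n : ℕ} (hn : 2 ≤ n) : nontrivialDivisor 1 n = 1 := by
  rw [nontrivialDivisor_succ (by omega), sum_eq_single n]
  · rw [Nat.div_self (by omega), nontrivialDivisor_zero_one]
  · intro k hk hkn
    apply nontrivialDivisor_zero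
    intro h
    have := Nat.div_mul_cancel (Nat.dvd_of_mem_divisors (mem_of_mem_erase hk))
    rw [h, one_mul] at this
    exact hkn this
  · intro h
    exact absurd (mem_erase.2 ⟨by omega, Nat.mem_divisors_self n (by omega)⟩) h

theorem cardFactors_div_lt {n k : ℕ} (hn : n ≠ 0) (hk : k ∈ n.divisors.erase 1) :
    Ω (n / k) < Ω n := by
  obtain ⟨hk1, hk⟩ := mem_erase.1 hk
  have hkn := Nat.dvd_of_mem_divisors hk
  obtain ⟨l, rfl⟩ := hkn
  have hk0 : k ≠ 0 := left_ne_zero_of_mul hn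
  have hl0 : l ≠ 0 := right_ne_zero_of_mul hn
  rw [Nat.mul_div_cancel_left _ (Nat.pos_of_ne_zero hk0),
    ArithmeticFunction.cardFactors_mul hk0 hl0]
  have : Ω k ≠ 0 := by
    rw [Ne, ArithmeticFunction.cardFactors_eq_zero_iff_eq_zero_or_one]
    tauto
  omega

theorem div_ne_zero_of_mem_divisors {n k : ℕ} (hk : k ∈ n.divisors) : n / k ≠ 0 := by
  have h := Nat.mem_divisors.1 hk
  exact (Nat.div_pos (Nat.le_of_dvd (by omega) h.1)
    (Nat.pos_of_dvd_of_pos h.1 (by omega))).ne'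

/-- Each factor uses up at least one prime. This makes the top terms vanish in the index shifts
below. -/
theorem nontrivialDivisor_eq_zero {j : ℕ} :
    ∀ {n : ℕ}, n ≠ 0 → Ω n < j → nontrivialDivisor j n = 0 := by
  induction j with
  | zero => intro n _ h; omega
  | succ j ih =>
    intro n hn h
    rw [nontrivialDivisor_succ hn]
    refine sum_eq_zero fun k hk => ih (div_ne_zero_of_mem_divisors (mem_of_mem_erase hk)) ?_
    have := cardFactors_div_lt hn hk
    omega

/-- In the sum of `c_j(n / k)` over `k ∣ n`, the term `k = 1` is `c_j(n)`; the others add a first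
factor `k`. -/
theorem assocDivisor_one {n : ℕ} (hn : n ≠ 0) (j : ℕ) :
    assocDivisor j 1 n = nontrivialDivisor j n + nontrivialDivisor (j + 1) n := by
  simp only [assocDivisor]
  rw [← Nat.sum_div_divisors, nontrivialDivisor_succ hn,
    ← add_sum_erase _ _ (Nat.one_mem_divisors.2 hn), Nat.div_one]

/-- The number of pairs of ordered factorisations of `a` and `b` into `j + 1` and either `j + 1`
or `j` factors respectively, with `j < J`. -/
def interlacedCount (J a b : ℕ) : ℕ :=
  ∑ j ∈ range J, nontrivialDivisor (j + 1) a *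
    (nontrivialDivisor (j + 1) b + nontrivialDivisor j b)

theorem interlacedCount_one_right {J a : ℕ} (ha : 2 ≤ a) (hJ : 0 < J) :
    interlacedCount J a 1 = 1 := by
  obtain ⟨J, rfl⟩ := Nat.exists_eq_succ_of_ne_zero hJ.ne'
  rw [interlacedCount, sum_range_succ', sum_eq_zero]
  · simp [nontrivialDivisor_one ha, nontrivialDivisor_one_one, nontrivialDivisor_zero_one]
  · intro j _
    rw [nontrivialDivisor_eq_zero one_ne_zero (by simp), nontrivialDivisor_eq_zero one_ne_zero
      (by simp), add_zero, mul_zero]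

/-- Removing the first factor `k` of `a` makes `b` the leading number. The diagonal terms `c_j(a /
k) c_j(b)` must then be shifted by one index; the boundary terms vanish because `c_0(b) = 0` and `Ω
(a / k) < J`. -/
theorem interlacedCount_eq_sum {J a b : ℕ} (ha : a ≠ 0) (hb : 2 ≤ b) (hJ : Ω a ≤ J) :
    interlacedCount J a b = ∑ k ∈ a.divisors.erase 1, interlacedCount J b (a / k) := by
  simp only [interlacedCount]
  rw [sum_comm (s := a.divisors.erase 1)]
  simp only [nontrivialDivisor_succ ha, sum_mul, mul_add, sum_add_distrib]
  rw [add_comm]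
  congr 1
  · rw [sum_comm, sum_comm (s := range J)]
    refine sum_congr rfl fun k hk => ?_
    have h := sum_range_succ'
      (fun j => nontrivialDivisor j (a / k) * nontrivialDivisor j b) J
    rw [sum_range_succ, nontrivialDivisor_zero (n := b) (by omega),
      nontrivialDivisor_eq_zero (n := a / k)
        (div_ne_zero_of_mem_divisors (mem_of_mem_erase hk))
        ((cardFactors_div_lt ha hk).trans_le hJ)] at h
    simp only [zero_mul, mul_zero, add_zero] at h
    rw [h]
    exact sum_congr rfl fun j _ => mul_comm _ _
  · refine sum_congr rfl fun j _ => sum_congr rfl fun k _ => mul_comm _ _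

theorem interlacedCount_self {n : ℕ} (hn : 2 ≤ n) : interlacedCount (Ω n) n n = countN n := by
  have hIcc : Icc 1 (Ω n) = (range (Ω n)).image (· + 1) := by
    ext x
    simp only [mem_Icc, mem_image, mem_range]
    exact ⟨fun h => ⟨x - 1, by omega, by omega⟩, by rintro ⟨y, hy, rfl⟩; omega⟩
  rw [interlacedCount, countN, hIcc, sum_image (by simp)]
  have hn0 : n ≠ 0 := by omega
  simp only [assocDivisor_one hn0, assocDivisor.eq_1, mul_add, sum_add_distrib]
  congr 1
  have h := sum_range_succ'
    (fun j => nontrivialDivisor (j + 1) n * nontrivialDivisor j n) (Ω n)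
  rw [sum_range_succ, nontrivialDivisor_zero (n := n) (by omega),
    nontrivialDivisor_eq_zero (j := Ω n + 1) hn0 (by omega)] at h
  simp only [zero_mul, mul_zero, add_zero] at h
  rw [h]
  exact sum_congr rfl fun j _ => mul_comm _ _

end DivisorCounts

/-! ### Structure of two-component sum systems -/

section SumSystems

open Finset
open scoped Pointwise

/-- `A` and `B` form a (two-component) sum system: the sums `a + b` with `a ∈ A`, `b ∈ B`
represent each of `0, 1, …, #A * #B - 1` exactly once. -/
def IsSumSystem (A B : Finset ℕ) : Prop :=
  A + B = range (#A * #B)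

namespace IsSumSystem

variable {A B : Finset ℕ}

theorem symm (h : IsSumSystem A B) : IsSumSystem B A := by
  rw [IsSumSystem, add_comm, mul_comm]
  exact h

theorem exists_iff (h : IsSumSystem A B) (x : ℕ) :
    (∃ a ∈ A, ∃ b ∈ B, a + b = x) ↔ x < #A * #B := by
  rw [← mem_range, ← h, mem_add]

theorem add_lt (h : IsSumSystem A B) {a b : ℕ} (ha : a ∈ A) (hb : b ∈ B) : a + b < #A * #B :=
  (h.exists_iff _).1 ⟨a, ha, b, hb, rfl⟩

/-- There are as many sums as pairs, so addition is injective on `A × B`. -/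
theorem unique (h : IsSumSystem A B) {a a' b b' : ℕ} (ha : a ∈ A) (ha' : a' ∈ A) (hb : b ∈ B)
    (hb' : b' ∈ B) (hab : a + b = a' + b') : a = a' ∧ b = b' := by
  have hc : #(A + B) = #A * #B := by rw [h, card_range]
  have := card_add_iff.1 hc (x₁ := (a, b)) (x₂ := (a', b')) ⟨ha, hb⟩ ⟨ha', hb'⟩ hab
  simpa using this

theorem zero_mem (h : IsSumSystem A B) (hA : A.Nonempty) (hB : B.Nonempty) :
    0 ∈ A ∧ 0 ∈ B := by
  obtain ⟨a, ha, b, hb, hab⟩ := (h.exists_iff 0).2 (Nat.mul_pos hA.card_pos hB.card_pos)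
  obtain ⟨rfl, rfl⟩ : a = 0 ∧ b = 0 := by omega
  exact ⟨ha, hb⟩

/-- If `k` is the least positive element of `B`, then `A` is a union of blocks
`{k * q, …, k * q + k - 1}`, and all elements of `B` are multiples of `k`. -/
theorem mem_block (h : IsSumSystem A B) (hA : 0 ∈ A) (hB : 0 ∈ B) {k : ℕ} (hk0 : 0 < k)
    (hk : k ∈ B) (hmin : ∀ b ∈ B, b < k → b = 0) (q : ℕ) :
    ∀ i < k, (k * q + i ∈ A ↔ k * q ∈ A) ∧ (k * q + i ∈ B → i = 0) := by
  induction q using Nat.strong_induction_on with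
  | _ q ih =>
  have hfirst : ∀ i < k, i ∈ A := by
    intro i hi
    have hlt := h.add_lt hA hk
    obtain ⟨a, ha, b, hb, hab⟩ := (h.exists_iff i).2 (by omega)
    have := hmin b hb (by omega)
    rwa [← hab, this, add_zero]
  have hdvd : ∀ b ∈ B, b < k * q → ∃ j < q, b = k * j := by
    intro b hb hbq
    have hj : b / k < q := Nat.div_lt_of_lt_mul hbq
    have hmod := Nat.div_add_mod b k
    have := (ih _ hj (b % k) (Nat.mod_lt _ hk0)).2 (by rwa [hmod])
    exact ⟨b / k, hj, by omega⟩
  have hblock : ∀ j < q, k * j ∈ A → ∀ i < k, k * j + i ∈ A := fun j hj hjA i hi =>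
    (ih j hj i hi).1.2 hjA
  have hblock' : ∀ j < q, ∀ i < k, k * j + i ∈ A → k * j ∈ A := fun j hj i hi =>
    (ih j hj i hi).1.1
  rcases Nat.eq_zero_or_pos q with rfl | hq
  · intro i hi
    simp only [mul_zero, zero_add]
    exact ⟨iff_of_true (hfirst i hi) hA, fun hiB => hmin i hiB hi⟩
  have hkq : k ≤ k * q := Nat.le_mul_of_pos_right k hq
  -- a representation of the first element of the block by positive summands
  -- represents the whole block
  have hsplit : ∀ j < q, 0 < j → k * j ∈ B → k * (q - j) ∈ A → ∀ i < k,
      k * q + i ∉ A ∧ k * q + i ∉ B := by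
    intro j hj hj0 hjB hjA i hi
    have hmem := hblock (q - j) (by omega) hjA i hi
    have hsum : k * (q - j) + k * j = k * q := by rw [← mul_add]; congr 1; omega
    have h1 : k ≤ k * (q - j) := Nat.le_mul_of_pos_right k (by omega)
    have h2 : k ≤ k * j := Nat.le_mul_of_pos_right k hj0
    constructor
    · intro hx
      have := h.unique hx hmem hB hjB (by omega)
      omega
    · intro hx
      have := h.unique hA hmem hx hjB (by omega)
      omega
  -- If `k * q ∈ B`, then `k * q + i` is already the sum `i + k * q` and can lie in neither set for
  -- `i > 0`, nor in `A` for `i = 0`.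
  by_cases hqB : k * q ∈ B
  · intro i hi
    have hnA : k * q + i ∉ A := by
      intro hx
      have := h.unique hx (hfirst i hi) hB hqB (by omega)
      omega
    have hnA' : k * q ∉ A := by
      intro hx
      have := h.unique hx hA hB hqB (by omega)
      omega
    refine ⟨iff_of_false hnA hnA', fun hx => ?_⟩
    have := h.unique hA (hfirst i hi) hx hqB (by omega)
    omega
  by_cases hqA : k * q ∈ A
  · have hnB : ∀ i < k, k * q + i ∉ B := by
      intro i hi hx
      rcases Nat.eq_zero_or_pos i with rfl | hi0
      · exact hqB hx
      -- Two representations of the same number: `k * q + k = (k - i) + (k * q + i)`.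
      · have := h.unique hqA (hfirst (k - i) (by omega)) hk hx (by omega)
        omega
    intro i hi
    refine ⟨iff_of_true ?_ hqA, fun hx => absurd hx (hnB i hi)⟩
    -- The sum `k * q + k` bounds `k * q + i`, which is therefore represented. A positive summand
    -- `b` would be a multiple of `k`, and shifting back by `i` would split `k * q` itself.
    have hlt := h.add_lt hqA hk
    obtain ⟨a, ha, b, hb, hab⟩ := (h.exists_iff (k * q + i)).2 (by omega)
    rcases Nat.eq_zero_or_pos b with rfl | hb0
    · rwa [← hab]
    exfalso
    rcases lt_or_ge b (k * q) with hbq | hbq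
    · obtain ⟨j, hj, rfl⟩ := hdvd b hb hbq
      have hj0 : 0 < j := Nat.pos_of_mul_pos_left hb0
      have hsum : k * (q - j) + k * j = k * q := by rw [← mul_add]; congr 1; omega
      have ha' : a = k * (q - j) + i := by omega
      subst ha'
      exact (hsplit j hj hj0 hb (hblock' _ (by omega) i hi ha) 0 hk0).1 (by simpa using hqA)
    · exact hnB (b - k * q) (by omega) (by rwa [Nat.add_sub_cancel' hbq])
  · have hdisj : ∀ i < k, k * q + i ∉ A ∧ k * q + i ∉ B := by
      by_cases hN : k * q < #A * #B
      · obtain ⟨a, ha, b, hb, hab⟩ := (h.exists_iff _).2 hN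
        have hb1 : b < k * q := by
          rcases Nat.eq_zero_or_pos a with rfl | ha0
          · rw [zero_add] at hab
            exact absurd (hab ▸ hb) hqB
          · omega
        obtain ⟨j, hj, rfl⟩ := hdvd b hb hb1
        have hj0 : 0 < j := by
          rcases Nat.eq_zero_or_pos j with rfl | hj0
          · rw [mul_zero, add_zero] at hab
            exact absurd (hab ▸ ha) hqA
          · exact hj0
        have hsum : k * (q - j) + k * j = k * q := by rw [← mul_add]; congr 1; omega
        have ha' : a = k * (q - j) := by omega
        exact hsplit j hj hj0 hb (ha' ▸ ha)
      · intro i hi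
        constructor
        · intro hx
          have := h.add_lt hx hB
          omega
        · intro hx
          have := h.add_lt hA hx
          omega
    intro i hi
    exact ⟨iff_of_false (hdisj i hi).1 hqA, fun hx => absurd hx (hdisj i hi).2⟩

end IsSumSystem

/-- The union of the blocks `{k * a, …, k * a + k - 1}` with `a ∈ A`. -/
def blocks (k : ℕ) (A : Finset ℕ) : Finset ℕ :=
  (range k ×ˢ A).image fun p => p.1 + k * p.2

theorem mem_blocks {k : ℕ} (hk : 0 < k) {A : Finset ℕ} {x : ℕ} : x ∈ blocks k A ↔ x / k ∈ A := by
  simp only [blocks, mem_image, mem_product, mem_range, Prod.exists]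
  constructor
  · rintro ⟨i, a, ⟨hi, ha⟩, rfl⟩
    rwa [Nat.add_mul_div_left _ _ hk, Nat.div_eq_of_lt hi, zero_add]
  · intro h
    exact ⟨x % k, x / k, ⟨Nat.mod_lt _ hk, h⟩, Nat.mod_add_div x k⟩

theorem mul_mem_blocks {k : ℕ} (hk : 0 < k) {A : Finset ℕ} {x : ℕ} :
    k * x ∈ blocks k A ↔ x ∈ A := by
  rw [mem_blocks hk, Nat.mul_div_cancel_left _ hk]

theorem card_blocks (k : ℕ) (A : Finset ℕ) : #(blocks k A) = k * #A := by
  rw [blocks, card_image_of_injOn, card_product, card_range]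
  rintro ⟨i, a⟩ hi ⟨j, b⟩ hj h
  simp only [coe_product, Set.mem_prod, mem_coe, mem_range] at hi hj h
  have hk : 0 < k := by omega
  have h1 := congrArg (· / k) h
  have h2 := congrArg (· % k) h
  simp only [Nat.add_mul_div_left _ _ hk, Nat.add_mul_mod_self_left, Nat.div_eq_of_lt hi.1,
    Nat.div_eq_of_lt hj.1, Nat.mod_eq_of_lt hi.1, Nat.mod_eq_of_lt hj.1, zero_add] at h1 h2
  rw [h1, h2]

/-- The dilation `k * B`. -/
def dilate (k : ℕ) (B : Finset ℕ) : Finset ℕ :=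
  B.image (k * ·)

theorem mul_mem_dilate {k : ℕ} (hk : 0 < k) {B : Finset ℕ} {x : ℕ} :
    k * x ∈ dilate k B ↔ x ∈ B := by
  simp [dilate, hk.ne']

theorem card_dilate {k : ℕ} (hk : 0 < k) (B : Finset ℕ) : #(dilate k B) = #B :=
  card_image_of_injective _ fun _ _ h => Nat.eq_of_mul_eq_mul_left hk h

/-- Full blocks absorb every remainder modulo `k`, so whether `x` is a sum depends only on `x / k`.
-/
theorem isSumSystem_blocks_dilate {k : ℕ} (hk : 0 < k) {A B : Finset ℕ} :
    IsSumSystem (blocks k A) (dilate k B) ↔ IsSumSystem A B := by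
  have hsum : ∀ x, x ∈ blocks k A + dilate k B ↔ x / k ∈ A + B := by
    intro x
    simp only [mem_add, dilate, exists_mem_image]
    constructor
    · rintro ⟨a, ha, b, hb, rfl⟩
      exact ⟨a / k, (mem_blocks hk).1 ha, b, hb, (Nat.add_mul_div_left _ _ hk).symm⟩
    · rintro ⟨a, ha, b, hb, hab⟩
      have := Nat.div_add_mod x k
      rw [← hab, mul_add] at this
      refine ⟨k * a + x % k, (mem_blocks hk).2 ?_, b, hb, by omega⟩
      rwa [Nat.mul_add_div hk, Nat.div_eq_of_lt (Nat.mod_lt _ hk), add_zero]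
  simp only [IsSumSystem, Finset.ext_iff, hsum, mem_range, card_blocks, card_dilate hk, mul_assoc]
  constructor
  · intro h x
    simpa [hk, hk.ne'] using h (k * x)
  · intro h x
    rw [h, Nat.div_lt_iff_lt_mul hk, mul_comm k]

theorem IsSumSystem.exists_blocks_dilate {A B : Finset ℕ} (h : IsSumSystem A B) (h1 : 1 ∈ A)
    (hB : 2 ≤ #B) : ∃ k A' B', 2 ≤ k ∧ A = blocks k A' ∧ B = dilate k B' ∧ 1 ∈ B' := by
  obtain ⟨hA0, hB0⟩ := h.zero_mem ⟨1, h1⟩ (card_pos.1 (by omega))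
  have hne : (B.erase 0).Nonempty := card_pos.1 (by rw [card_erase_of_mem hB0]; omega)
  obtain ⟨k, hk, hmin⟩ := exists_min_image _ id hne
  obtain ⟨hk0, hkB⟩ := mem_erase.1 hk
  replace hk0 := Nat.pos_of_ne_zero hk0
  have hblk := h.mem_block hA0 hB0 hk0 hkB fun b hb hbk => by
    by_contra hb0
    exact absurd (hmin b (mem_erase.2 ⟨hb0, hb⟩)) (not_le.2 hbk)
  have hdvd : ∀ b ∈ B, k * (b / k) = b := by
    intro b hb
    have := Nat.div_add_mod b k
    have := (hblk (b / k) (b % k) (Nat.mod_lt _ hk0)).2 (by rwa [this])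
    omega
  refine ⟨k, (A.filter (k ∣ ·)).image (· / k), B.image (· / k), ?_, ?_, ?_, ?_⟩
  · by_contra hk2
    obtain rfl : k = 1 := by omega
    have := h.unique h1 hA0 hB0 hkB (by omega)
    omega
  · ext x
    have hx := (hblk (x / k) (x % k) (Nat.mod_lt _ hk0)).1
    rw [Nat.div_add_mod] at hx
    simp only [mem_blocks hk0, hx, mem_image, mem_filter]
    constructor
    · intro hxA
      exact ⟨_, ⟨hxA, dvd_mul_right _ _⟩, Nat.mul_div_cancel_left _ hk0⟩
    · rintro ⟨y, ⟨hy, hky⟩, hxy⟩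
      rwa [← hxy, Nat.mul_div_cancel' hky]
  · exact (image_id.symm.trans (image_congr fun b hb => (hdvd b hb).symm)).trans image_image.symm
  · exact mem_image.2 ⟨k, hkB, Nat.div_self hk0⟩

theorem IsSumSystem.eq_range {A B : Finset ℕ} (h : IsSumSystem A B) (hA : A.Nonempty)
    (hB : #B = 1) : A = range #A ∧ B = {0} := by
  have hB0 := (h.zero_mem hA (card_pos.1 (by omega))).2
  obtain ⟨b, rfl⟩ := card_eq_one.1 hB
  obtain rfl := mem_singleton.1 hB0
  refine ⟨?_, rfl⟩
  simpa [IsSumSystem, singleton_zero] using h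

/-- `A` is invariant under a reflection `x ↦ s - x` of `{0, …, s}`. -/
def IsPalindromic (A : Finset ℕ) : Prop :=
  ∃ s, ∀ x ∈ A, x ≤ s ∧ s - x ∈ A

theorem IsPalindromic.blocks {A : Finset ℕ} (h : IsPalindromic A) {k : ℕ} (hk : 0 < k) :
    IsPalindromic (blocks k A) := by
  obtain ⟨s, hs⟩ := h
  -- Reflection sends block `a` to block `s - a` and reverses it, whence the offset `k - 1`.
  refine ⟨k * s + (k - 1), fun x hx => ?_⟩
  obtain ⟨hle, hmem⟩ := hs _ ((mem_blocks hk).1 hx)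
  have hx := Nat.div_add_mod x k
  have hlt := Nat.mod_lt x hk
  have hsub : k * (s - x / k) + k * (x / k) = k * s := by rw [← mul_add, Nat.sub_add_cancel hle]
  refine ⟨by omega, (mem_blocks hk).2 ?_⟩
  have : k * s + (k - 1) - x = k * (s - x / k) + (k - 1 - x % k) := by omega
  rwa [this, Nat.mul_add_div hk, Nat.div_eq_of_lt (by omega : k - 1 - x % k < k), add_zero]

theorem IsPalindromic.dilate {B : Finset ℕ} (h : IsPalindromic B) (k : ℕ) :
    IsPalindromic (dilate k B) := by
  obtain ⟨s, hs⟩ := h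
  refine ⟨k * s, fun x hx => ?_⟩
  obtain ⟨b, hb, rfl⟩ := mem_image.1 hx
  exact ⟨Nat.mul_le_mul_left k (hs b hb).1,
    mem_image.2 ⟨s - b, (hs b hb).2, Nat.mul_sub k s b⟩⟩

/-- Intervals are palindromic, and both blocks and dilations preserve this; induction follows the
decomposition, exchanging the sets each time. -/
theorem IsSumSystem.isPalindromic {A B : Finset ℕ} (h : IsSumSystem A B) (h1 : 1 ∈ A)
    (hB : B.Nonempty) : IsPalindromic A ∧ IsPalindromic B := by
  obtain ⟨N, hN⟩ : ∃ N, #A + #B = N := ⟨_, rfl⟩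
  induction N using Nat.strong_induction_on generalizing A B with
  | _ N ih =>
  rcases (Nat.succ_le_of_lt hB.card_pos).eq_or_lt with hB1 | hB2
  · obtain ⟨hA, rfl⟩ := h.eq_range ⟨1, h1⟩ hB1.symm
    constructor
    · refine ⟨#A - 1, fun x hx => ?_⟩
      have hmem : ∀ y, y ∈ A ↔ y < #A := fun y => (Finset.ext_iff.1 hA y).trans mem_range
      rw [hmem] at hx ⊢
      omega
    · exact ⟨0, by simp⟩
  · obtain ⟨k, A', B', hk, rfl, rfl, h1'⟩ := h.exists_blocks_dilate h1 hB2
    have hk0 : 0 < k := by omega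
    have hA' : 0 < #A' := by
      have := card_pos.2 ⟨1, h1⟩
      rw [card_blocks] at this
      exact Nat.pos_of_mul_pos_left this
    rw [card_blocks, card_dilate hk0] at hN
    have : 2 * #A' ≤ k * #A' := Nat.mul_le_mul_right _ hk
    obtain ⟨hB, hA⟩ := ih _ (by omega) ((isSumSystem_blocks_dilate hk0).1 h).symm h1'
      (card_pos.1 hA') rfl
    exact ⟨hA.blocks hk0, hB.dilate k⟩

end SumSystems

/-! ### Counting sum systems by the same recursion -/

section Counting

open Finset
open scoped ArithmeticFunction.Omega Pointwise

open scoped Classical in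
/-- The finite set of sum systems `(A, B)` with `#A = a`, `#B = b` and `1 ∈ A`. -/
noncomputable def sumSystems (a b : ℕ) : Finset (Finset ℕ × Finset ℕ) :=
  ((range (a * b)).powerset ×ˢ (range (a * b)).powerset).filter fun p =>
    #p.1 = a ∧ #p.2 = b ∧ IsSumSystem p.1 p.2 ∧ 1 ∈ p.1

theorem mem_sumSystems {a b : ℕ} (hb : b ≠ 0) {A B : Finset ℕ} :
    (A, B) ∈ sumSystems a b ↔ #A = a ∧ #B = b ∧ IsSumSystem A B ∧ 1 ∈ A := by
  simp only [sumSystems, mem_filter, mem_product, mem_powerset, and_iff_right_iff_imp]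
  rintro ⟨rfl, rfl, h, h1⟩
  obtain ⟨hA0, hB0⟩ := h.zero_mem ⟨1, h1⟩ (card_ne_zero.1 hb)
  exact ⟨fun x hx => mem_range.2 (h.add_lt hx hB0),
    fun x hx => mem_range.2 (by simpa using h.add_lt hA0 hx)⟩

theorem card_sumSystems_one {a : ℕ} (ha : 2 ≤ a) : #(sumSystems a 1) = 1 := by
  refine card_eq_one.2 ⟨(range a, {0}), ?_⟩
  ext ⟨A, B⟩
  rw [mem_sumSystems one_ne_zero, mem_singleton, Prod.mk.injEq]
  constructor
  · rintro ⟨rfl, hB, h, h1⟩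
    exact h.eq_range ⟨1, h1⟩ hB
  · rintro ⟨rfl, rfl⟩
    exact ⟨card_range a, card_singleton 0, by simp [IsSumSystem, singleton_zero],
      mem_range.2 (by omega)⟩

theorem card_sumSystems {a b : ℕ} (ha : a ≠ 0) (hb : 2 ≤ b) :
    #(sumSystems a b) = ∑ k ∈ a.divisors.erase 1, #(sumSystems b (a / k)) := by
  rw [← card_sigma]
  symm
  have key : ∀ {p : Σ _ : ℕ, Finset ℕ × Finset ℕ},
      p ∈ (a.divisors.erase 1).sigma (fun k => sumSystems b (a / k)) →
      2 ≤ p.1 ∧ #p.2.1 = b ∧ p.1 * #p.2.2 = a ∧ IsSumSystem p.2.1 p.2.2 ∧ 1 ∈ p.2.1 := by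
    rintro ⟨k, B, A⟩ h
    obtain ⟨hk, h⟩ := mem_sigma.1 h
    obtain ⟨hk1, hk⟩ := mem_erase.1 hk
    obtain ⟨hB, hA, hs, h1⟩ := (mem_sumSystems (div_ne_zero_of_mem_divisors hk)).1 h
    have hdvd := Nat.dvd_of_mem_divisors hk
    have := Nat.pos_of_dvd_of_pos hdvd (by omega)
    dsimp only at *
    exact ⟨by omega, hB, by rw [hA, Nat.mul_div_cancel' hdvd], hs, h1⟩
  refine card_bij (fun p _ => (blocks p.1 p.2.2, dilate p.1 p.2.1)) ?_ ?_ ?_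
  · intro p hp
    obtain ⟨hk, hB, hA, hs, h1⟩ := key hp
    have hk0 : 0 < p.1 := by omega
    refine (mem_sumSystems (by omega)).2 ⟨by rw [card_blocks, hA], by rw [card_dilate hk0, hB],
      (isSumSystem_blocks_dilate hk0).2 hs.symm, (mem_blocks hk0).2 ?_⟩
    rw [Nat.div_eq_of_lt hk]
    exact (hs.zero_mem ⟨1, h1⟩ (card_ne_zero.1 fun h => by simp [h] at hA; omega)).2
  · rintro ⟨k, B, A⟩ hp ⟨l, B', A'⟩ hp' heq
    obtain ⟨hk, -, -, -, h1⟩ := key hp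
    obtain ⟨hl, -, -, -, h1'⟩ := key hp'
    dsimp only at hk hl h1 h1' heq
    obtain ⟨hA, hB⟩ := Prod.mk.injEq _ _ _ _ ▸ heq
    have hk0 : 0 < k := by omega
    have hl0 : 0 < l := by omega
    -- As 1 lies in both `B` and `B'`, each of `k` and `l` belongs to the common dilate and is a
    -- multiple of the other.
    have hkl : k ∣ l := by
      have : l * 1 ∈ dilate k B := hB ▸ (mul_mem_dilate hl0).2 h1'
      obtain ⟨x, -, hx⟩ := mem_image.1 this
      exact ⟨x, by rw [hx, mul_one]⟩
    have hlk : l ∣ k := by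
      have : k * 1 ∈ dilate l B' := hB ▸ (mul_mem_dilate hk0).2 h1
      obtain ⟨x, -, hx⟩ := mem_image.1 this
      exact ⟨x, by rw [hx, mul_one]⟩
    obtain rfl := Nat.dvd_antisymm hkl hlk
    have hBB : B = B' := by
      ext x
      rw [← mul_mem_dilate hk0, hB, mul_mem_dilate hk0]
    have hAA : A = A' := by
      ext x
      rw [← mul_mem_blocks hk0, hA, mul_mem_blocks hk0]
    rw [hBB, hAA]
  · rintro ⟨A, B⟩ h
    obtain ⟨hA, hB, hs, h1⟩ := (mem_sumSystems (by omega)).1 h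
    obtain ⟨k, A', B', hk, rfl, rfl, h1'⟩ := hs.exists_blocks_dilate h1 (by omega)
    have hk0 : 0 < k := by omega
    rw [card_blocks] at hA
    rw [card_dilate hk0] at hB
    have hkmem : k ∈ a.divisors := Nat.mem_divisors.2 ⟨⟨_, hA.symm⟩, ha⟩
    refine ⟨⟨k, B', A'⟩, mem_sigma.2 ⟨mem_erase.2 ⟨by simp; omega, hkmem⟩, ?_⟩, rfl⟩
    refine (mem_sumSystems (div_ne_zero_of_mem_divisors hkmem)).2
      ⟨hB, ?_, ((isSumSystem_blocks_dilate hk0).1 hs).symm, h1'⟩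
    rw [← hA, Nat.mul_div_cancel_left _ hk0]

theorem card_sumSystems_eq_interlacedCount {J : ℕ} (hJ : 0 < J) {a b : ℕ} (ha : a ≠ 0)
    (hb : b ≠ 0) (hab : 2 ≤ a ∨ 2 ≤ b) (haJ : Ω a ≤ J) (hbJ : Ω b ≤ J) :
    #(sumSystems a b) = interlacedCount J a b := by
  obtain ⟨N, hN⟩ : ∃ N, a + b = N := ⟨_, rfl⟩
  induction N using Nat.strong_induction_on generalizing a b with
  | _ N ih =>
  rcases (Nat.one_le_iff_ne_zero.2 hb).eq_or_lt with rfl | hb2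
  · have ha2 : 2 ≤ a := by omega
    rw [card_sumSystems_one ha2, interlacedCount_one_right ha2 hJ]
  · rw [card_sumSystems ha hb2, interlacedCount_eq_sum ha hb2 haJ]
    refine sum_congr rfl fun k hk => ?_
    obtain ⟨hk1, hkd⟩ := mem_erase.1 hk
    have hk0 := Nat.pos_of_mem_divisors hkd
    have hlt : a / k < a := Nat.div_lt_self (by omega) (by omega)
    exact ih _ (by omega) hb (div_ne_zero_of_mem_divisors hkd) (Or.inl hb2) hbJ
      ((cardFactors_div_lt ha hk).le.trans haJ) rfl

theorem card_sumSystems_self {n : ℕ} (hn : 2 ≤ n) : #(sumSystems n n) = countN n := by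
  rw [← interlacedCount_self hn]
  refine card_sumSystems_eq_interlacedCount ?_ (by omega) (by omega) (Or.inl hn) le_rfl le_rfl
  rw [Nat.pos_iff_ne_zero, Ne, ArithmeticFunction.cardFactors_eq_zero_iff_eq_zero_or_one]
  omega

end Counting

/-! ### Passing between sum systems and centrally symmetric sets -/

section Centred

open Finset
open scoped Pointwise

/-- The half of a palindromic set `A ⊆ {0, …, s}`, `s = max A`, consisting of the distances
`|2 * x - s|` for `x ∈ A`. -/
def symmHalf (A : Finset ℕ) : Finset ℕ :=
  A.image fun x : ℕ => (2 * (x : ℤ) - (A.sup id : ℕ)).natAbs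

/-- The palindromic set with half `C`. -/
def symmReflect (C : Finset ℕ) : Finset ℕ :=
  (range (C.sup id + 1)).filter fun x => (2 * (x : ℤ) - (C.sup id : ℕ)).natAbs ∈ C

theorem mem_symmReflect {C : Finset ℕ} {x : ℕ} :
    x ∈ symmReflect C ↔ x ≤ C.sup id ∧ (2 * (x : ℤ) - (C.sup id : ℕ)).natAbs ∈ C := by
  rw [symmReflect, mem_filter, mem_range, Nat.lt_succ_iff]

theorem le_sup_id {C : Finset ℕ} {c : ℕ} (hc : c ∈ C) : c ≤ C.sup id :=
  le_sup (f := id) hc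

theorem sup_id_mem {C : Finset ℕ} (hC : C.Nonempty) : C.sup id ∈ C := by
  obtain ⟨c, hc, h⟩ := exists_mem_eq_sup C hC id
  rw [h]
  exact hc

theorem sup_id_eq {C : Finset ℕ} {s : ℕ} (hs : s ∈ C) (h : ∀ c ∈ C, c ≤ s) : C.sup id = s :=
  le_antisymm (Finset.sup_le h) (le_sup_id hs)

theorem IsPalindromic.sup_sub_mem {A : Finset ℕ} (h : IsPalindromic A) (h0 : 0 ∈ A) {x : ℕ}
    (hx : x ∈ A) : A.sup id - x ∈ A := by
  obtain ⟨s, hs⟩ := h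
  rw [sup_id_eq (by simpa using (hs 0 h0).2) fun c hc => (hs c hc).1]
  exact (hs x hx).2

theorem sup_symmHalf {A : Finset ℕ} (h0 : 0 ∈ A) : (symmHalf A).sup id = A.sup id := by
  refine sup_id_eq (mem_image.2 ⟨0, h0, by omega⟩) fun c hc => ?_
  obtain ⟨a, ha, rfl⟩ := mem_image.1 hc
  have := le_sup_id ha
  omega

/-- The distance `|2x - s|` determines `x` up to the reflection that preserves `A`. -/
theorem symmReflect_symmHalf {A : Finset ℕ} (h : IsPalindromic A) (h0 : 0 ∈ A) :
    symmReflect (symmHalf A) = A := by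
  ext x
  rw [mem_symmReflect, sup_symmHalf h0, symmHalf, mem_image]
  constructor
  · rintro ⟨hx, a, ha, hax⟩
    have ha' := le_sup_id ha
    rcases (by omega : x = a ∨ x = A.sup id - a) with rfl | rfl
    · exact ha
    · exact h.sup_sub_mem h0 ha
  · intro hx
    exact ⟨le_sup_id hx, x, hx, rfl⟩

theorem symmHalf_mod_two {A : Finset ℕ} (h0 : 0 ∈ A) {c : ℕ} (hc : c ∈ symmHalf A) :
    c % 2 = (symmHalf A).sup id % 2 := by
  rw [sup_symmHalf h0]
  obtain ⟨a, ha, rfl⟩ := mem_image.1 hc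
  omega

theorem sup_symmReflect {C : Finset ℕ} (hC : C.Nonempty) : (symmReflect C).sup id = C.sup id := by
  refine sup_id_eq (mem_symmReflect.2 ⟨le_rfl, ?_⟩) fun c hc => (mem_symmReflect.1 hc).1
  convert sup_id_mem hC
  omega

theorem symmHalf_symmReflect {C : Finset ℕ} (hC : C.Nonempty)
    (hpar : ∀ c ∈ C, c % 2 = C.sup id % 2) :
    symmHalf (symmReflect C) = C := by
  ext c
  rw [symmHalf, sup_symmReflect hC, mem_image]
  constructor
  · rintro ⟨x, hx, rfl⟩
    exact (mem_symmReflect.1 hx).2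
  · intro hc
    have hle := le_sup_id hc
    have hp := hpar c hc
    have : (2 * (((C.sup id + c) / 2 : ℕ) : ℤ) - (C.sup id : ℕ)).natAbs = c := by omega
    exact ⟨(C.sup id + c) / 2, mem_symmReflect.2 ⟨by omega, by rwa [this]⟩, this⟩

theorem add_half_mem_symmReflect {C : Finset ℕ} {c : ℕ} (hc : c ∈ C)
    (hpar : c % 2 = C.sup id % 2) : (C.sup id + c) / 2 ∈ symmReflect C := by
  have hle := le_sup_id hc
  refine mem_symmReflect.2 ⟨by omega, ?_⟩
  convert hc
  omega

theorem sub_half_mem_symmReflect {C : Finset ℕ} {c : ℕ} (hc : c ∈ C)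
    (hpar : c % 2 = C.sup id % 2) : (C.sup id - c) / 2 ∈ symmReflect C := by
  have hle := le_sup_id hc
  refine mem_symmReflect.2 ⟨by omega, ?_⟩
  convert hc
  omega

/-- Each `c` yields the two points `(s ± c) / 2`, which coincide only for `c = 0`. -/
theorem card_symmReflect {C : Finset ℕ} (hpar : ∀ c ∈ C, c % 2 = C.sup id % 2) :
    #(symmReflect C) + (if 0 ∈ C then 1 else 0) = 2 * #C := by
  set s := C.sup id with hs
  have hle : ∀ c ∈ C, c ≤ s := fun c hc => le_sup_id hc
  have hunion : symmReflect C = C.image (fun c => (s + c) / 2) ∪ C.image (fun c => (s - c) / 2) := by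
    ext x
    simp only [mem_symmReflect, mem_union, mem_image, ← hs]
    constructor
    · rintro ⟨hx, hc⟩
      rcases le_total s (2 * x) with h | h
      · exact Or.inl ⟨_, hc, by omega⟩
      · exact Or.inr ⟨_, hc, by omega⟩
    · rintro (⟨c, hc, rfl⟩ | ⟨c, hc, rfl⟩)
      · exact mem_symmReflect.1 (add_half_mem_symmReflect hc (hpar c hc))
      · exact mem_symmReflect.1 (sub_half_mem_symmReflect hc (hpar c hc))
  have hinter : C.image (fun c => (s + c) / 2) ∩ C.image (fun c => (s - c) / 2) =
      (C.filter (· = 0)).image fun c => (s + c) / 2 := by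
    ext x
    simp only [mem_inter, mem_image, mem_filter]
    constructor
    · rintro ⟨⟨c, hc, rfl⟩, d, hd, hcd⟩
      have h1 := hle d hd
      have h2 := hpar c hc
      have h3 := hpar d hd
      exact ⟨c, ⟨hc, by omega⟩, rfl⟩
    · rintro ⟨c, ⟨hc, rfl⟩, rfl⟩
      exact ⟨⟨0, hc, rfl⟩, 0, hc, rfl⟩
  have hinj1 : Set.InjOn (fun c => (s + c) / 2) (C : Set ℕ) := by
    intro c hc d hd hcd
    have h1 := hpar c hc
    have h2 := hpar d hd
    dsimp only at hcd
    omega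
  have hinj2 : Set.InjOn (fun c => (s - c) / 2) (C : Set ℕ) := by
    intro c hc d hd hcd
    have h1 := hpar c hc
    have h2 := hpar d hd
    have h3 := hle c hc
    have h4 := hle d hd
    dsimp only at hcd
    omega
  have hcard := card_union_add_card_inter (C.image fun c => (s + c) / 2)
    (C.image fun c => (s - c) / 2)
  rw [← hunion, hinter, card_image_of_injOn hinj1, card_image_of_injOn hinj2,
    card_image_of_injOn (hinj1.mono (coe_subset.2 (filter_subset _ _))), filter_eq', ← two_mul] at hcard
  rw [← hcard]
  split_ifs <;> simp

/-- `C` and `D` are the halves of two centrally symmetric sets of `n` integers whose sums are the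
integers of absolute value less than `n ^ 2` of the parity of `n ^ 2 - 1`. -/
def IsCentredSystem (n : ℕ) (C D : Finset ℕ) : Prop :=
  2 * #C = n + (if 0 ∈ C then 1 else 0) ∧ 2 * #D = n + (if 0 ∈ D then 1 else 0) ∧
    ∀ x : ℕ, (∃ c ∈ C, ∃ d ∈ D, x = c + d ∨ x = ((c : ℤ) - d).natAbs) ↔
      x < n * n ∧ x % 2 = (n * n - 1) % 2

namespace IsCentredSystem

variable {n : ℕ} {C D : Finset ℕ}

theorem symm (h : IsCentredSystem n C D) : IsCentredSystem n D C := by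
  refine ⟨h.2.1, h.1, fun x => (h.2.2 x).symm.trans ?_ |>.symm⟩
  constructor
  · rintro ⟨c, hc, d, hd, h⟩
    exact ⟨d, hd, c, hc, by omega⟩
  · rintro ⟨c, hc, d, hd, h⟩
    exact ⟨d, hd, c, hc, by omega⟩

theorem nonempty (h : IsCentredSystem n C D) (hn : 0 < n) : C.Nonempty ∧ D.Nonempty :=
  ⟨card_pos.1 (by have := h.1; omega), card_pos.1 (by have := h.2.1; omega)⟩

theorem add_mod_two (h : IsCentredSystem n C D) {c d : ℕ} (hc : c ∈ C) (hd : d ∈ D) :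
    (c + d) % 2 = (n * n - 1) % 2 :=
  ((h.2.2 _).1 ⟨c, hc, d, hd, Or.inl rfl⟩).2

theorem mod_two (h : IsCentredSystem n C D) (hn : 0 < n) {c : ℕ} (hc : c ∈ C) :
    c % 2 = C.sup id % 2 := by
  obtain ⟨hC, d, hd⟩ := h.nonempty hn
  have h1 := h.add_mod_two hc hd
  have h2 := h.add_mod_two (sup_id_mem hC) hd
  omega

theorem sup_add_sup (h : IsCentredSystem n C D) (hn : 0 < n) :
    C.sup id + D.sup id + 1 = n * n := by
  obtain ⟨hC, hD⟩ := h.nonempty hn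
  have hpos := Nat.mul_pos hn hn
  have h1 := ((h.2.2 _).1 ⟨_, sup_id_mem hC, _, sup_id_mem hD, Or.inl rfl⟩).1
  obtain ⟨c, hc, d, hd, h2⟩ := (h.2.2 (n * n - 1)).2 ⟨by omega, rfl⟩
  have h3 := le_sup_id hc
  have h4 := le_sup_id hd
  omega

theorem card_symmReflect (h : IsCentredSystem n C D) (hn : 0 < n) : #(symmReflect C) = n := by
  have h1 := _root_.card_symmReflect fun c hc => h.mod_two hn hc
  have h2 := h.1
  omega

theorem symmHalf_symmReflect (h : IsCentredSystem n C D) (hn : 0 < n) :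
    symmHalf (symmReflect C) = C :=
  _root_.symmHalf_symmReflect (h.nonempty hn).1 fun _ hc => h.mod_two hn hc

theorem isSumSystem (h : IsCentredSystem n C D) (hn : 0 < n) :
    IsSumSystem (symmReflect C) (symmReflect D) := by
  have hsup := h.sup_add_sup hn
  ext y
  rw [h.card_symmReflect hn, h.symm.card_symmReflect hn, mem_add, mem_range]
  constructor
  · rintro ⟨a, ha, b, hb, rfl⟩
    have := (mem_symmReflect.1 ha).1
    have := (mem_symmReflect.1 hb).1
    omega
  · intro hy
    obtain ⟨c, hc, d, hd, hx⟩ := (h.2.2 (2 * (y : ℤ) - (n * n - 1 : ℕ)).natAbs).2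
      ⟨by omega, by omega⟩
    have h1 := le_sup_id hc
    have h2 := le_sup_id hd
    have h3 := h.mod_two hn hc
    have h4 := h.symm.mod_two hn hd
    have hcp := add_half_mem_symmReflect hc h3
    have hcm := sub_half_mem_symmReflect hc h3
    have hdp := add_half_mem_symmReflect hd h4
    have hdm := sub_half_mem_symmReflect hd h4
    -- The centred value of `y` is `±c ± d`; each sign selects the upper or lower point over `c` or
    -- `d`.
    have hcases : 2 * (y : ℤ) - (n * n - 1 : ℕ) = c + d ∨
        2 * (y : ℤ) - (n * n - 1 : ℕ) = -c - d ∨ 2 * (y : ℤ) - (n * n - 1 : ℕ) = c - d ∨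
        2 * (y : ℤ) - (n * n - 1 : ℕ) = d - c := by omega
    rcases hcases with h5 | h5 | h5 | h5
    · exact ⟨_, hcp, _, hdp, by omega⟩
    · exact ⟨_, hcm, _, hdm, by omega⟩
    · exact ⟨_, hcp, _, hdm, by omega⟩
    · exact ⟨_, hcm, _, hdp, by omega⟩

/-- A common `c` would give 0 the two representations `c + (-c)` and `0 + 0`. -/
theorem eq_zero_of_mem (h : IsCentredSystem n C D) (hn : 0 < n) (hC : 0 ∈ C) (hD : 0 ∈ D)
    {c : ℕ} (hcC : c ∈ C) (hcD : c ∈ D) : c = 0 := by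
  have h1 := h.mod_two hn hC
  have h2 := h.symm.mod_two hn hD
  have h3 := h.mod_two hn hcC
  have h4 := h.symm.mod_two hn hcD
  have h5 := le_sup_id hcD
  have := (h.isSumSystem hn).unique (add_half_mem_symmReflect hcC h3)
    (add_half_mem_symmReflect hC h1) (sub_half_mem_symmReflect hcD h4)
    (sub_half_mem_symmReflect hD h2) (by omega)
  omega

end IsCentredSystem

theorem IsSumSystem.isCentredSystem {A B : Finset ℕ} (h : IsSumSystem A B) {n : ℕ} (hn : 0 < n)
    (hA : #A = n) (hB : #B = n) (hpA : IsPalindromic A) (hpB : IsPalindromic B) :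
    IsCentredSystem n (symmHalf A) (symmHalf B) := by
  have hAne : A.Nonempty := card_pos.1 (by omega)
  have hBne : B.Nonempty := card_pos.1 (by omega)
  obtain ⟨hA0, hB0⟩ := h.zero_mem hAne hBne
  have hcA := card_symmReflect fun c hc => symmHalf_mod_two hA0 hc
  have hcB := card_symmReflect fun c hc => symmHalf_mod_two hB0 hc
  rw [symmReflect_symmHalf hpA hA0, hA] at hcA
  rw [symmReflect_symmHalf hpB hB0, hB] at hcB
  have hsup : A.sup id + B.sup id + 1 = n * n := by
    have h1 := h.add_lt (sup_id_mem hAne) (sup_id_mem hBne)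
    have hpos := Nat.mul_pos hn hn
    rw [hA, hB] at h1
    obtain ⟨a, ha, b, hb, hab⟩ := (h.exists_iff (n * n - 1)).2 (by rw [hA, hB]; omega)
    have h2 := le_sup_id ha
    have h3 := le_sup_id hb
    omega
  refine ⟨hcA.symm, hcB.symm, fun x => ?_⟩
  constructor
  · rintro ⟨c, hc, d, hd, hx⟩
    obtain ⟨a, ha, rfl⟩ := mem_image.1 hc
    obtain ⟨b, hb, rfl⟩ := mem_image.1 hd
    have h1 := le_sup_id ha
    have h2 := le_sup_id hb
    omega
  · rintro ⟨hx, hpar⟩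
    obtain ⟨a, ha, b, hb, hab⟩ := (h.exists_iff ((n * n - 1 + x) / 2)).2 (by rw [hA, hB]; omega)
    exact ⟨_, mem_image_of_mem _ ha, _, mem_image_of_mem _ hb, by omega⟩

theorem encard_isCentredSystem {n : ℕ} (hn : 2 ≤ n) :
    {S : Finset (Finset ℕ) | ∃ C D, S = {C, D} ∧ IsCentredSystem n C D}.encard = countN n := by
  have hn0 : 0 < n := by omega
  have key : ∀ {A B : Finset ℕ}, (A, B) ∈ sumSystems n n → #A = n ∧ #B = n ∧ IsSumSystem A B ∧
      1 ∈ A ∧ 0 ∈ A ∧ 0 ∈ B ∧ IsPalindromic A ∧ IsPalindromic B := by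
    intro A B h
    obtain ⟨hA, hB, hs, h1⟩ := (mem_sumSystems hn0.ne').1 h
    have hBne : B.Nonempty := card_pos.1 (by omega)
    obtain ⟨hA0, hB0⟩ := hs.zero_mem ⟨1, h1⟩ hBne
    exact ⟨hA, hB, hs, h1, hA0, hB0, hs.isPalindromic h1 hBne⟩
  have himage : {S : Finset (Finset ℕ) | ∃ C D, S = {C, D} ∧ IsCentredSystem n C D} =
      (fun p : Finset ℕ × Finset ℕ => ({symmHalf p.1, symmHalf p.2} : Finset (Finset ℕ))) ''
        (sumSystems n n : Set (Finset ℕ × Finset ℕ)) := by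
    ext S
    constructor
    · rintro ⟨C, D, rfl, h⟩
      have hs := h.isSumSystem hn0
      have hA := h.card_symmReflect hn0
      have hB := h.symm.card_symmReflect hn0
      have hlt : 1 < n * n := by nlinarith
      obtain ⟨a, ha, b, hb, hab⟩ := (hs.exists_iff 1).2 (by rwa [hA, hB])
      rcases (by omega : a = 1 ∨ b = 1) with rfl | rfl
      · refine ⟨(symmReflect C, symmReflect D), (mem_sumSystems hn0.ne').2 ⟨hA, hB, hs, ha⟩, ?_⟩
        dsimp only
        rw [h.symmHalf_symmReflect hn0, h.symm.symmHalf_symmReflect hn0]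
      · refine ⟨(symmReflect D, symmReflect C), (mem_sumSystems hn0.ne').2 ⟨hB, hA, hs.symm, hb⟩, ?_⟩
        dsimp only
        rw [h.symmHalf_symmReflect hn0, h.symm.symmHalf_symmReflect hn0, pair_comm]
    · rintro ⟨⟨A, B⟩, h, rfl⟩
      obtain ⟨hA, hB, hs, -, -, -, hpA, hpB⟩ := key h
      exact ⟨_, _, rfl, hs.isCentredSystem hn0 hA hB hpA hpB⟩
  rw [himage, Set.InjOn.encard_image, Set.encard_coe_eq_coe_finsetCard, card_sumSystems_self hn]
  rintro ⟨A, B⟩ h ⟨A', B'⟩ h' heq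
  obtain ⟨-, -, -, h1, hA0, hB0, hpA, hpB⟩ := key h
  obtain ⟨-, -, hs', h1', hA0', hB0', hpA', hpB'⟩ := key h'
  have heq' : ({symmHalf A, symmHalf B} : Set (Finset ℕ)) = {symmHalf A', symmHalf B'} := by
    simpa using congrArg (fun S : Finset (Finset ℕ) => (S : Set (Finset ℕ))) heq
  rcases Set.pair_eq_pair_iff.1 heq' with ⟨hA, hB⟩ | ⟨hA, -⟩
  · rw [← symmReflect_symmHalf hpA hA0, ← symmReflect_symmHalf hpB hB0, hA, hB, symmReflect_symmHalf hpA' hA0',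
      symmReflect_symmHalf hpB' hB0']
  -- If the pair were swapped, 1 would lie in both `A'` and `B'`, against `1 + 0 = 0 + 1`.
  · have hAB : A = B' := by rw [← symmReflect_symmHalf hpA hA0, hA, symmReflect_symmHalf hpB' hB0']
    have := hs'.unique h1' hA0' hB0' (hAB ▸ h1) (by omega)
    omega

end Centred

/-! ### Translation to sum-and-distance systems -/

section SumDistSystems

open Finset

/-- For even `n`, parity in `2 * #C = n + [0 ∈ C]` keeps 0 out of each half. -/
theorem isSumDistSystem_iff {m : ℕ} {S : Finset (Finset ℕ)} :
    IsSumDistSystem m S ↔ ∃ C D, S = {C, D} ∧ IsCentredSystem (2 * m) C D := by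
  refine exists_congr fun A => exists_congr fun B => and_congr_right fun _ => ?_
  have hz : 4 * (m : ℤ) ^ 2 = (4 * (m * m) : ℕ) := by push_cast; ring
  have hN : 2 * m * (2 * m) = 4 * (m * m) := by ring
  rw [IsCentredSystem, hN, Set.ext_iff]
  simp only [Set.mem_ofPred_eq, hz, Int.odd_iff, Int.abs_eq_natAbs]
  generalize m * m = M
  constructor
  · rintro ⟨hA, hB, hA0, hB0, h⟩
    refine ⟨?_, ?_, fun x => ?_⟩
    · rw [if_neg fun h0 => (hA0 0 h0).ne rfl, hA, add_zero]
    · rw [if_neg fun h0 => (hB0 0 h0).ne rfl, hB, add_zero]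
    · constructor
      · rintro ⟨a, ha, b, hb, hab⟩
        have := (h x).1 ⟨a, ha, b, hb, by omega⟩
        omega
      · intro hx
        obtain ⟨a, ha, b, hb, hab⟩ := (h x).2 (by omega)
        exact ⟨a, ha, b, hb, by omega⟩
  · rintro ⟨hA, hB, h⟩
    have hA0 : 0 ∉ A := fun h0 => by rw [if_pos h0] at hA; omega
    have hB0 : 0 ∉ B := fun h0 => by rw [if_pos h0] at hB; omega
    rw [if_neg hA0] at hA
    rw [if_neg hB0] at hB
    refine ⟨by omega, by omega, fun a ha => Nat.pos_of_ne_zero fun h0 => hA0 (h0 ▸ ha),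
      fun b hb => Nat.pos_of_ne_zero fun h0 => hB0 (h0 ▸ hb), fun x => ?_⟩
    constructor
    · rintro ⟨a, ha, b, hb, hab⟩
      have := (h x.natAbs).1 ⟨a, ha, b, hb, by omega⟩
      omega
    · intro hx
      obtain ⟨a, ha, b, hb, hab⟩ := (h x.natAbs).2 (by omega)
      exact ⟨a, ha, b, hb, by omega⟩

/-- The set `2 * A ∪ {0}`. -/
def doubleWithZero (A : Finset ℕ) : Finset ℕ :=
  insert 0 (A.image (2 * ·))

/-- The set of positive halves of elements of `C`, an inverse of `doubleWithZero`. -/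
def halveWithoutZero (C : Finset ℕ) : Finset ℕ :=
  (C.image (· / 2)).erase 0

theorem halveWithoutZero_doubleWithZero {A : Finset ℕ} (h : 0 ∉ A) :
    halveWithoutZero (doubleWithZero A) = A := by
  ext x
  simp only [halveWithoutZero, doubleWithZero, mem_erase, mem_image, mem_insert,
    exists_eq_or_imp, exists_exists_and_eq_and]
  constructor
  · rintro ⟨hx, h0 | ⟨a, ha, hax⟩⟩
    · omega
    · rwa [← hax, Nat.mul_div_cancel_left _ two_pos]
  · intro hx
    exact ⟨fun h0 => h (h0 ▸ hx), Or.inr ⟨x, hx, by omega⟩⟩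

theorem doubleWithZero_halveWithoutZero {C : Finset ℕ} (h : 0 ∈ C) (heven : ∀ c ∈ C, c % 2 = 0) :
    doubleWithZero (halveWithoutZero C) = C := by
  ext x
  simp only [halveWithoutZero, doubleWithZero, mem_erase, mem_image, mem_insert]
  constructor
  · rintro (rfl | ⟨a, ⟨-, c, hc, hca⟩, hax⟩)
    · exact h
    · have := heven c hc
      rwa [(by omega : x = c)]
  · intro hx
    have := heven x hx
    by_cases h0 : x = 0
    · exact Or.inl h0
    · exact Or.inr ⟨x / 2, ⟨by omega, x, hx, rfl⟩, by omega⟩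

theorem card_doubleWithZero (A : Finset ℕ) (h : 0 ∉ A) : #(doubleWithZero A) = #A + 1 := by
  rw [doubleWithZero, card_insert_of_notMem (by simpa using h),
    card_image_of_injective _ fun a b hab => Nat.eq_of_mul_eq_mul_left two_pos hab]

theorem isCentredSystem_doubleWithZero_iff {m : ℕ} (hm : 1 ≤ m) {A B : Finset ℕ} :
    (0 ∉ A ∧ 0 ∉ B ∧ IsCentredSystem (2 * m + 1) (doubleWithZero A) (doubleWithZero B)) ↔
      A.card = m ∧ B.card = m ∧ (∀ a ∈ A, 0 < a) ∧ (∀ b ∈ B, 0 < b) ∧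
      {x : ℤ | ∃ a ∈ A, ∃ b ∈ B,
          x = (a : ℤ) ∨ x = (b : ℤ) ∨ x = (a : ℤ) + b ∨ x = |(a : ℤ) - b|} =
        {x : ℤ | 1 ≤ x ∧ x ≤ 2 * (m : ℤ) * (m + 1)} := by
  have hz : 2 * (m : ℤ) * (m + 1) = (2 * (m * m + m) : ℕ) := by push_cast; ring
  have hN : (2 * m + 1) * (2 * m + 1) = 4 * (m * m + m) + 1 := by ring
  have h0A : 0 ∈ doubleWithZero A := mem_insert_self _ _
  have h0B : 0 ∈ doubleWithZero B := mem_insert_self _ _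
  have hpos : ∀ T : Finset ℕ, 0 ∉ T ↔ ∀ t ∈ T, 0 < t := fun T =>
    ⟨fun h t ht => Nat.pos_of_ne_zero fun h0 => h (h0 ▸ ht), fun h h0 => (h 0 h0).ne rfl⟩
  have hdisj : IsCentredSystem (2 * m + 1) (doubleWithZero A) (doubleWithZero B) →
      ∀ a ∈ A, a ∈ B → a = 0 := fun h a ha hb => by
    have := h.eq_zero_of_mem (by omega) h0A h0B (c := 2 * a)
      (mem_insert_of_mem (mem_image_of_mem _ ha)) (mem_insert_of_mem (mem_image_of_mem _ hb))
    omega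
  rw [IsCentredSystem, hN, if_pos h0A, if_pos h0B] at hdisj ⊢
  rw [Set.ext_iff]
  simp only [Set.mem_ofPred_eq, hz, Int.abs_eq_natAbs]
  have hm' : m ≤ m * m + m := Nat.le_add_left _ _
  generalize m * m + m = M at hm' hdisj ⊢
  rw [← hpos, ← hpos]
  by_cases hA0 : 0 ∈ A
  · simp [hA0]
  by_cases hB0 : 0 ∈ B
  · simp [hB0]
  have hAp := (hpos A).1 hA0
  have hBp := (hpos B).1 hB0
  rw [card_doubleWithZero A hA0, card_doubleWithZero B hB0] at hdisj ⊢
  simp only [hA0, hB0, not_false_eq_true, true_and]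
  rw [(by omega : 2 * (#A + 1) = 2 * m + 1 + 1 ↔ #A = m),
    (by omega : 2 * (#B + 1) = 2 * m + 1 + 1 ↔ #B = m)]
  refine and_congr_right fun hA => and_congr_right fun hB => ?_
  -- Sums with one summand 0 involve only `A` or only `B`; `a₀` and `b₀` fill the idle quantifier.
  obtain ⟨a₀, ha₀⟩ : A.Nonempty := card_pos.1 (by omega)
  obtain ⟨b₀, hb₀⟩ : B.Nonempty := card_pos.1 (by omega)
  have hsums : ∀ x : ℕ, (∃ c ∈ doubleWithZero A, ∃ d ∈ doubleWithZero B,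
      x = c + d ∨ x = ((c : ℤ) - d).natAbs) ↔ x = 0 ∨ ∃ a ∈ A, ∃ b ∈ B,
      x = 2 * a ∨ x = 2 * b ∨ x = 2 * (a + b) ∨ x = 2 * ((a : ℤ) - b).natAbs := by
    intro x
    simp only [doubleWithZero, exists_mem_insert, exists_mem_image]
    constructor
    · rintro ((hx | ⟨b, hb, hx⟩) | ⟨a, ha, hx | ⟨b, hb, hx⟩⟩)
      · exact Or.inl (by omega)
      · exact Or.inr ⟨a₀, ha₀, b, hb, by omega⟩
      · exact Or.inr ⟨a, ha, b₀, hb₀, by omega⟩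
      · exact Or.inr ⟨a, ha, b, hb, by omega⟩
    · rintro (hx | ⟨a, ha, b, hb, hx | hx | hx⟩)
      · exact Or.inl (Or.inl (by omega))
      · exact Or.inr ⟨a, ha, Or.inl (by omega)⟩
      · exact Or.inl (Or.inr ⟨b, hb, by omega⟩)
      · exact Or.inr ⟨a, ha, Or.inr ⟨b, hb, by omega⟩⟩
  simp only [hsums]
  constructor
  · intro h x
    constructor
    · rintro ⟨a, ha, b, hb, hx⟩
      have h1 := (h (2 * x.natAbs)).1 (Or.inr ⟨a, ha, b, hb, by omega⟩)
      have h2 := hAp a ha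
      have h3 := hBp b hb
      -- The distance 0 is allowed in the centred system but not in the inclusive one.
      have h4 : a ≠ b := by
        rintro rfl
        have := hdisj ⟨by omega, by omega, fun x => (hsums x).trans (h x)⟩ a ha hb
        omega
      omega
    · intro hx
      rcases (h (2 * x.natAbs)).2 (by omega) with h0 | ⟨a, ha, b, hb, hab⟩
      · omega
      · exact ⟨a, ha, b, hb, by omega⟩
  · intro h x
    constructor
    · rintro (rfl | ⟨a, ha, b, hb, hx⟩)
      · omega
      · have := (h (x / 2 : ℕ)).1 ⟨a, ha, b, hb, by omega⟩
        omega
    · intro hx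
      by_cases h0 : x = 0
      · exact Or.inl h0
      · obtain ⟨a, ha, b, hb, hab⟩ := (h (x / 2 : ℕ)).2 (by omega)
        exact Or.inr ⟨a, ha, b, hb, by omega⟩

theorem halveWithoutZero_image {S : Finset (Finset ℕ)} (h : ∀ A ∈ S, 0 ∉ A) :
    (S.image doubleWithZero).image halveWithoutZero = S := by
  rw [image_image]
  exact (image_congr fun A hA => halveWithoutZero_doubleWithZero (h A hA)).trans image_id

/-- For odd `n`, the cardinality condition forces 0 into each half; the common parity then makes all
elements even, so halving is lossless. -/
theorem image_isInclusiveSumDistSystem {m : ℕ} (hm : 1 ≤ m) :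
    (fun S => S.image doubleWithZero) '' {S : Finset (Finset ℕ) | IsInclusiveSumDistSystem m S} =
      {S | ∃ C D, S = {C, D} ∧ IsCentredSystem (2 * m + 1) C D} := by
  ext S
  constructor
  · rintro ⟨-, ⟨A, B, rfl, h⟩, rfl⟩
    exact ⟨_, _, by simp [image_insert], ((isCentredSystem_doubleWithZero_iff hm).2 h).2.2⟩
  · rintro ⟨C, D, rfl, h⟩
    have hmem : ∀ {C D}, IsCentredSystem (2 * m + 1) C D → 0 ∈ C := by
      intro C D h
      by_contra h0
      have := h.1
      rw [if_neg h0] at this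
      omega
    have hdouble : ∀ {C D}, IsCentredSystem (2 * m + 1) C D →
        doubleWithZero (halveWithoutZero C) = C := by
      intro C D h
      refine doubleWithZero_halveWithoutZero (hmem h) fun c hc => ?_
      have h1 := h.mod_two (by omega) hc
      have h2 := h.mod_two (by omega) (hmem h)
      omega
    refine ⟨{halveWithoutZero C, halveWithoutZero D}, ⟨_, _, rfl,
      (isCentredSystem_doubleWithZero_iff hm).1 ⟨notMem_erase _ _, notMem_erase _ _, ?_⟩⟩, ?_⟩
    · rwa [hdouble h, hdouble h.symm]
    · simp [image_insert, hdouble h, hdouble h.symm]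

end SumDistSystems

theorem mainTheorem3 (m : ℕ) (hm : 1 ≤ m) :
    {S : Finset (Finset ℕ) | IsSumDistSystem m S}.encard = (countN (2 * m) : ℕ∞) ∧
    {S : Finset (Finset ℕ) | IsInclusiveSumDistSystem m S}.encard =
      (countN (2 * m + 1) : ℕ∞) := by
  constructor
  · simp only [isSumDistSystem_iff]
    exact encard_isCentredSystem (by omega)
  · rw [← encard_isCentredSystem (n := 2 * m + 1) (by omega), ← image_isInclusiveSumDistSystem hm]
    refine (Set.InjOn.encard_image fun S hS T hT hST => ?_).symm
    have key : ∀ {S}, IsInclusiveSumDistSystem m S → ∀ A ∈ S, 0 ∉ A := by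
      rintro S ⟨A, B, rfl, -, -, hA, hB, -⟩ C hC h0
      rcases Finset.mem_insert.1 hC with rfl | hC
      · exact (hA 0 h0).ne rfl
      · exact (hB 0 (Finset.mem_singleton.1 hC ▸ h0)).ne rfl
    rw [← halveWithoutZero_image (key hS), ← halveWithoutZero_image (key hT)]
    exact congrArg _ hST
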